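/- All topological spaces are assumed to be Hausdorff. An ideal on a set $X$ is a family $\mathcal I\subseteq\mathcal P(X)$ with $X\notin\mathcal I$ that contains all finite subsets of $X$ and is closed under subsets and finite unions; $\mathcal I^+=\mathcal P(X)\setminus\mathcal I$. Let $\Omega,\Lambda$ be countably infinite sets. Let $\mathcal F$ be a nonempty family of infinite subsets of $\Omega$ such that $F\setminus K\in\mathcal F$ for all $F\in\mathcal F$ and all finite $K\subseteq\Omega$. A function $\rho\colon\mathcal F\to[\Lambda]^\omega$ (with values infinite subsets of $\Lambda$) is *partition regular* if - (M) $E\subseteq F$ implies $\rho(E)\subseteq\rho(F)$ for all $E,F\in\mathcal F$; - (R) if $F\in\mathcal F$ and $\rho(F)=A\cup B$, then there is $E\in\mathcal F$ with $\rho(E)\subseteq A$ or $\rho(E)\subseteq B$; - (S) for every $E\in\mathcal F$ there is $F\in\mathcal F$ with $F\subseteq E$ such that for every $a\in\rho(F)$ there is a finite $K\subseteq\Omega$ with $a\notin\rho(F\setminus K)$. Put $\mathcal I_\rho=\{A\subseteq\Lambda:\rho(F)\not\subseteq A\text{ for all }F\in\mathcal F\}$. For an ideal $\mathcal I$ on a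 countably infinite set $X$, $\rho_{\mathcal I}\colon\mathcal I^+\to[X]^\omega$ is the partition regular function $\rho_{\mathcal I}(A)=A$. - $\rho\in(S_2)$ if for every $E\in\mathcal F$ there is $F\in\mathcal F$ with $F\subseteq E$ such that for every $B\notin\mathcal I_\rho$ with $B\subseteq\rho(F)$ there is $G\in\mathcal F$ with $\rho(G)\subseteq B$ such that for every finite $K\subseteq\Omega$ there is a finite $L\subseteq\Omega$ with $\rho(G\setminus L)\subseteq\rho(F\setminus K)$. - $\rho\in P_1^-(\Lambda)$ if for every sequence $\Lambda=A_0\supseteq A_1\supseteq\dots$ with $A_n\setminus A_{n+1}\in\mathcal I_\rho$ for all $n$ there is $F\in\mathcal F$ such that for every $n$ there is a finite $K$ with $\rho(F\setminus K)\subseteq A_n$. - $\rho\in P_2^-(\Lambda)$ if for every partition $\{A_{i,j}:i,j\in\omega\}$ of $\Lambda$ (into pairwise disjoint, possibly empty sets) with all $A_{i,j}\in\mathcal I_\rho$ there is $F\in\mathcal F$ such that (a) for all $i,j$ there is a finite $K$ with $\rho(F\setminus K)\cap A_{i,j}=\emptyset$, and (b) there is $i_0$ such that for every $i>i_0$ there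 is a finite $K$ with $\rho(F\setminus K)\cap\bigcup_j A_{i,j}=\emptyset$. - For partition regular $\rho_i\colon\mathcal F_i\to[\Lambda_i]^\omega$, $\mathcal F_i\subseteq[\Omega_i]^\omega$ ($i=1,2$), $\rho_2\leq_K\rho_1$ means that there is $f\colon\Lambda_1\to\Lambda_2$ such that for every $F_1\in\mathcal F_1$ there is $F_2\in\mathcal F_2$ such that for every finite $K_1\subseteq\Omega_1$ there is a finite $K_2\subseteq\Omega_2$ with $\rho_2(F_2\setminus K_2)\subseteq f[\rho_1(F_1\setminus K_1)]$. - $\mathrm{FIN}^2$ is the ideal on $\omega^2$ of all $A$ for which there is $i_0$ such that $\{j:(i,j)\in A\}$ is finite for all $i\ge i_0$. $\mathsf{BI}$ is the ideal on $\omega^3$ of all $A$ for which there is $i_0$ such that $\{(j,k):(i,j,k)\in A\}\in\mathrm{FIN}^2$ for all $i<i_0$ and $\{(j,k):(i,j,k)\in A\}$ is finite for all $i\ge i_0$. - $\mathrm{FinBW}(\rho)$ is the class of all spaces $X$ such that for every $f\colon\Lambda\to X$ there are $F\in\mathcal F$ and $x\in X$ such that for every neighbourhood $U$ of $x$ there is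 a finite $K\subseteq\Omega$ with $f[\rho(F\setminus K)]\subseteq U$. - A space $X$ is *boring* if it is sequentially compact and there is a finite set $F\subseteq X$ such that each one-to-one convergent sequence in $X$ converges to some point of $F$. **Theorem.** Let $\rho\colon\mathcal F\to[\Lambda]^\omega$ be partition regular with $\rho\in(S_2)$. The following conditions are equivalent. 1. $\rho_{\mathsf{BI}}\leq_K\rho$ and $\rho_{\mathrm{FIN}^2}\not\leq_K\rho$. 2. $\rho\in P_1^-(\Lambda)$ and $\rho\notin P_2^-(\Lambda)$. 3. $\mathrm{FinBW}(\rho)$ coincides with the class of all boring spaces. -/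

import Mathlib

open Filter Topology Set

universe u v w v' w'

/-- An ideal on a set `X`: a proper family of subsets of `X` which is closed under finite unions
and subsets and contains all finite sets. -/
structure SetIdeal (X : Type u) where
  sets : Set (Set X)
  empty_mem : ∅ ∈ sets
  univ_notMem : univ ∉ sets
  union_mem : ∀ A B : Set X, A ∈ sets → B ∈ sets → A ∪ B ∈ sets
  subset_mem : ∀ A B : Set X, A ⊆ B → B ∈ sets → A ∈ sets
  finite_mem : ∀ A : Set X, A.Finite → A ∈ sets

/-- A partition regular function `ρ : 𝓕 → [Λ]^ω` with `𝓕 ⊆ [Ω]^ω`. The domain `𝓕` is the field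
`dom`; `toFun` is only ever evaluated at members of `dom`, and its values elsewhere are irrelevant.
(`Ω` and `Λ` are assumed to be countably infinite in the theorem.) -/
structure PartitionRegular (Ω : Type v) (Λ : Type w) where
  dom : Set (Set Ω)
  toFun : Set Ω → Set Λ
  dom_nonempty : dom.Nonempty
  infinite_of_mem_dom : ∀ F ∈ dom, F.Infinite
  diff_mem_dom : ∀ F ∈ dom, ∀ K : Finset Ω, F \ (K : Set Ω) ∈ dom
  infinite_toFun : ∀ F ∈ dom, (toFun F).Infinite
  /-- Condition (M). -/
  mono : ∀ E ∈ dom, ∀ F ∈ dom, E ⊆ F → toFun E ⊆ toFun F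
  /-- Condition (R). -/
  regular : ∀ F ∈ dom, ∀ A B : Set Λ, toFun F = A ∪ B →
    ∃ E ∈ dom, toFun E ⊆ A ∨ toFun E ⊆ B
  /-- Condition (S). -/
  sparse : ∀ E ∈ dom, ∃ F ∈ dom, F ⊆ E ∧
    ∀ a ∈ toFun F, ∃ K : Finset Ω, a ∉ toFun (F \ (K : Set Ω))

/-- The partition regular function `ρ_I : I⁺ → [X]^ω`, `ρ_I(A) = A`, given by an ideal `I`. -/
def SetIdeal.rho {X : Type u} (I : SetIdeal X) : PartitionRegular X X where
  dom := {A | A ∉ I.sets}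
  toFun := fun A => A
  dom_nonempty := ⟨univ, I.univ_notMem⟩
  infinite_of_mem_dom := fun F hF hfin => hF (I.finite_mem F hfin)
  diff_mem_dom := fun F hF K h => hF
    (I.subset_mem F ((F \ (K : Set X)) ∪ (K : Set X)) (by simp)
      (I.union_mem _ _ h (I.finite_mem _ K.finite_toSet)))
  infinite_toFun := fun F hF hfin => hF (I.finite_mem F hfin)
  mono := fun _ _ _ _ h => h
  regular := by
    intro F hF A B hAB
    by_cases hA : A ∈ I.sets
    · refine ⟨B, fun hB => hF ?_, Or.inr subset_rfl⟩
      have hAB' : F = A ∪ B := hAB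
      rw [hAB']
      exact I.union_mem _ _ hA hB
    · exact ⟨A, hA, Or.inl subset_rfl⟩
  sparse := fun E hE => ⟨E, hE, subset_rfl, fun a _ => ⟨{a}, by simp⟩⟩

/-- The family `FIN²`: `A ∈ FIN²` iff all but finitely many vertical sections of `A` are finite. -/
def fin2Sets : Set (Set (ℕ × ℕ)) :=
  {A | ∃ i₀ : ℕ, ∀ i ≥ i₀, {j : ℕ | (i, j) ∈ A}.Finite}

/-- The family `BI` of subsets of `ω³`. -/
def biSets : Set (Set (ℕ × ℕ × ℕ)) :=
  {A | ∃ i₀ : ℕ,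
    (∀ i < i₀, {p : ℕ × ℕ | (i, p.1, p.2) ∈ A} ∈ fin2Sets) ∧
    (∀ i ≥ i₀, {p : ℕ × ℕ | (i, p.1, p.2) ∈ A}.Finite)}

theorem fin2Sets_finite (A : Set (ℕ × ℕ)) (hA : A.Finite) : A ∈ fin2Sets :=
  ⟨0, fun _ _ => hA.preimage (fun _ _ _ _ h => (Prod.mk.inj h).2)⟩

theorem fin2Sets_union (A B : Set (ℕ × ℕ)) (hA : A ∈ fin2Sets) (hB : B ∈ fin2Sets) :
    A ∪ B ∈ fin2Sets := by
  obtain ⟨a, ha⟩ := hA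
  obtain ⟨b, hb⟩ := hB
  exact ⟨max a b, fun i hi =>
    (ha i (le_trans (le_max_left _ _) hi)).union (hb i (le_trans (le_max_right _ _) hi))⟩

theorem fin2Sets_subset (A B : Set (ℕ × ℕ)) (hAB : A ⊆ B) (hB : B ∈ fin2Sets) :
    A ∈ fin2Sets := by
  obtain ⟨b, hb⟩ := hB
  exact ⟨b, fun i hi => (hb i hi).subset fun _ hj => hAB hj⟩

/-- The ideal `FIN² = FIN ⊗ FIN` on `ω²`. -/
def idealFIN2 : SetIdeal (ℕ × ℕ) where
  sets := fin2Sets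
  empty_mem := fin2Sets_finite ∅ finite_empty
  univ_notMem := by
    rintro ⟨i₀, h⟩
    have := h i₀ le_rfl
    simp only [mem_univ, setOf_true] at this
    exact infinite_univ this
  union_mem := fin2Sets_union
  subset_mem := fin2Sets_subset
  finite_mem := fin2Sets_finite

/-- The ideal `BI` on `ω³`. -/
def idealBI : SetIdeal (ℕ × ℕ × ℕ) where
  sets := biSets
  empty_mem := ⟨0, fun _ h => absurd h (Nat.not_lt_zero _), fun _ _ => by simp⟩
  univ_notMem := by
    rintro ⟨i₀, -, h⟩
    have := h i₀ le_rfl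
    simp only [mem_univ, setOf_true] at this
    exact infinite_univ this
  union_mem := by
    rintro A B ⟨a, ha, ha'⟩ ⟨b, hb, hb'⟩
    refine ⟨max a b, fun i _ => ?_, fun i hi => ?_⟩
    · refine fin2Sets_union _ _ ?_ ?_
      · by_cases h : i < a
        · exact ha i h
        · exact fin2Sets_finite _ (ha' i (not_lt.mp h))
      · by_cases h : i < b
        · exact hb i h
        · exact fin2Sets_finite _ (hb' i (not_lt.mp h))
    · exact (ha' i (le_trans (le_max_left _ _) hi)).union
        (hb' i (le_trans (le_max_right _ _) hi))
  subset_mem := by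
    rintro A B hAB ⟨b, hb, hb'⟩
    exact ⟨b, fun i hi => fin2Sets_subset _ _ (fun _ hp => hAB hp) (hb i hi),
      fun i hi => (hb' i hi).subset fun _ hp => hAB hp⟩
  finite_mem := fun A hA => ⟨0, fun _ h => absurd h (Nat.not_lt_zero _), fun _ _ =>
    hA.preimage (fun _ _ _ _ h => (Prod.mk.inj h).2)⟩

namespace PartitionRegular

variable {Ω : Type v} {Λ : Type w} {Ω' : Type v'} {Λ' : Type w'}

/-- The ideal `I_ρ = {A ⊆ Λ : ρ(F) ⊄ A for all F ∈ 𝓕}`. -/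
def ideal (ρ : PartitionRegular Ω Λ) : Set (Set Λ) :=
  {A | ∀ F ∈ ρ.dom, ¬ ρ.toFun F ⊆ A}

/-- The Katětov order: `KatetovLE ρ₂ ρ₁` means `ρ₂ ≤_K ρ₁`. -/
def KatetovLE (ρ₂ : PartitionRegular Ω' Λ') (ρ₁ : PartitionRegular Ω Λ) : Prop :=
  ∃ f : Λ → Λ', ∀ F₁ ∈ ρ₁.dom, ∃ F₂ ∈ ρ₂.dom, ∀ K₁ : Finset Ω, ∃ K₂ : Finset Ω',
    ρ₂.toFun (F₂ \ (K₂ : Set Ω')) ⊆ f '' ρ₁.toFun (F₁ \ (K₁ : Set Ω))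

/-- The property `(S₂)`. -/
def S2 (ρ : PartitionRegular Ω Λ) : Prop :=
  ∀ E ∈ ρ.dom, ∃ F ∈ ρ.dom, F ⊆ E ∧
    ∀ B : Set Λ, B ∉ ρ.ideal → B ⊆ ρ.toFun F →
      ∃ G ∈ ρ.dom, ρ.toFun G ⊆ B ∧
        ∀ K : Finset Ω, ∃ L : Finset Ω,
          ρ.toFun (G \ (L : Set Ω)) ⊆ ρ.toFun (F \ (K : Set Ω))

/-- The property `P₁⁻(Λ)`, i.e. `P⁻(Λ)`. -/
def P1Minus (ρ : PartitionRegular Ω Λ) : Prop :=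
  ∀ A : ℕ → Set Λ, A 0 = univ → (∀ n, A (n + 1) ⊆ A n) →
    (∀ n, A n \ A (n + 1) ∈ ρ.ideal) →
    ∃ F ∈ ρ.dom, ∀ n, ∃ K : Finset Ω, ρ.toFun (F \ (K : Set Ω)) ⊆ A n

/-- The property `P₂⁻(Λ)`; the members of a partition indexed by `ω × ω` may be empty. -/
def P2Minus (ρ : PartitionRegular Ω Λ) : Prop :=
  ∀ A : ℕ → ℕ → Set Λ,
    (∀ i j i' j', (i, j) ≠ (i', j') → Disjoint (A i j) (A i' j')) →
    (⋃ i, ⋃ j, A i j) = univ →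
    (∀ i j, A i j ∈ ρ.ideal) →
    ∃ F ∈ ρ.dom,
      (∀ i j, ∃ K : Finset Ω, ρ.toFun (F \ (K : Set Ω)) ∩ A i j = ∅) ∧
      (∃ i₀, ∀ i > i₀, ∃ K : Finset Ω, ρ.toFun (F \ (K : Set Ω)) ∩ ⋃ j, A i j = ∅)

/-- `f ↾ ρ(F)` `ρ`-converges to `x`. -/
def ConvergesTo {X : Type u} [TopologicalSpace X] (ρ : PartitionRegular Ω Λ) (f : Λ → X)
    (F : Set Ω) (x : X) : Prop :=
  ∀ U ∈ 𝓝 x, ∃ K : Finset Ω, f '' ρ.toFun (F \ (K : Set Ω)) ⊆ U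

/-- The space `X` belongs to the class `FinBW(ρ)`. -/
def FinBW (ρ : PartitionRegular Ω Λ) (X : Type u) [TopologicalSpace X] : Prop :=
  ∀ f : Λ → X, ∃ F ∈ ρ.dom, ∃ x : X, ρ.ConvergesTo f F x

end PartitionRegular

/-- A sequentially compact space is boring if there is a finite set `F` such that each one-to-one
convergent sequence in the space converges to some point of `F`. -/
def BoringSpace (X : Type u) [TopologicalSpace X] : Prop :=
  SeqCompactSpace X ∧ ∃ F : Set X, F.Finite ∧
    ∀ s : ℕ → X, Function.Injective s → (∃ x, Tendsto s atTop (𝓝 x)) →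
      ∃ x ∈ F, Tendsto s atTop (𝓝 x)

/-!
For `F ∈ ρ.dom` the sets `ρ(F \ K)`, `K` finite, generate a filter `ρ.tail F`, and the ideal `I_ρ`
has a dual filter. In these terms `P₁⁻` says that every `g : Λ → ℕ` tending to `cofinite` along the
dual filter does so along some tail; `P₂⁻` says the same for `g : Λ → ℕ × ℕ`, where moreover almost
every row is eventually avoided; and `ρ_I ≤_K ρ` says that under some map the image of every tail is
coarser than the filter of cofinite subsets of some `I`-positive set.

Suppose `g` witnesses the failure of `P₁⁻` (or of `P₂⁻`). By `(S₂)` every tail frequently visits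
infinitely many fibres of `g` (or infinitely many rows, or infinitely many fibres in one row), for
otherwise it could be refined to a tail contradicting the choice of `g`. A pseudo-intersection of
the tail that is infinite on each of the visited pieces becomes positive for `FIN²` (or for `BI`)
once an injective coordinate is added to `g`, and this is the Katětov reduction.

Up to finitely many points, a boring space is a finite union of pieces whose cofinite filters
converge, so under `P₁⁻` and `(S₂)` a single piece captures a tail. Conversely, a sequentially
compact Hausdorff space that is not boring contains infinitely many disjoint one-to-one sequences
with distinct limits; if it is in `FinBW(ρ)`, mapping `Λ` into this array along any
`g : Λ → ℕ × ℕ` yields a tail as required in `P₂⁻`. The remaining implication is tested on `ℕ∞`, and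
on the one-point compactification of `ℕ × ℕ∞` (the ordinal `ω² + 1`), which is not boring but
belongs to `FinBW(ρ)` under `P₂⁻`.
-/

section Filters

variable {α β ι : Type*} {l : Filter α}

theorem tendsto_cofinite_iff_eventually_ne {f : α → β} :
    Tendsto f l cofinite ↔ ∀ y, ∀ᶠ a in l, f a ≠ y :=
  le_cofinite_iff_eventually_ne

theorem tendsto_comp_cofinite_iff_of_injOn {γ : Type*} {f : α → β} {c : β → γ}
    (hc : InjOn c (range f)) : Tendsto (c ∘ f) l cofinite ↔ Tendsto f l cofinite := by
  simp only [tendsto_cofinite_iff_eventually_ne]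
  refine ⟨fun h y => (h (c y)).mono fun a ha hay => ha (congrArg c hay), fun h z => ?_⟩
  by_cases hz : ∃ b, c (f b) = z
  · obtain ⟨b, rfl⟩ := hz
    exact (h (f b)).mono fun a ha hab => ha (hc (mem_range_self a) (mem_range_self b) hab)
  · exact .of_forall fun a ha => hz ⟨a, ha⟩

theorem mem_cofinite_inf_principal_iff {D S : Set α} :
    S ∈ cofinite ⊓ 𝓟 D ↔ (D \ S).Finite := by
  rw [mem_inf_principal, mem_cofinite]
  simp only [compl_def, mem_ofPred_eq, Classical.not_imp]
  rfl

theorem finite_inter_of_cofinite_inf_principal_le_map {f : α → β} {D A : Set β}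
    (hD : cofinite ⊓ 𝓟 D ≤ map f l) (hA : ∀ᶠ a in l, f a ∉ A) : (D ∩ A).Finite := by
  have hmem : Aᶜ ∈ cofinite ⊓ 𝓟 D := hD hA
  rwa [mem_cofinite_inf_principal_iff, sdiff_compl] at hmem

theorem cofinite_inf_principal_image_le_map (f : α → β) (D : Set α) :
    cofinite ⊓ 𝓟 (f '' D) ≤ map f (cofinite ⊓ 𝓟 D) := by
  intro S hS
  rw [mem_map, mem_cofinite_inf_principal_iff] at hS
  rw [mem_cofinite_inf_principal_iff]
  refine (hS.image f).subset ?_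
  rintro _ ⟨⟨a, haD, rfl⟩, haS⟩
  exact ⟨a, ⟨haD, haS⟩, rfl⟩

theorem cofinite_inf_principal_range_le_map (f : α → β) :
    cofinite ⊓ 𝓟 (range f) ≤ map f cofinite := by
  simpa using cofinite_inf_principal_image_le_map f univ

theorem infinite_range_of_tendsto_cofinite [Infinite α] {f : α → β}
    (hf : Tendsto f cofinite cofinite) : (range f).Infinite := fun hfin => by
  simpa [mem_cofinite, infinite_univ.not_finite] using hf hfin.compl_mem_cofinite

theorem exists_pseudoIntersection [Countable ι] [l.IsCountablyGenerated] (hl : l ≤ cofinite)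
    (C : ι → Set α) :
    ∃ D : Set α, cofinite ⊓ 𝓟 D ≤ l ∧ ∀ i, (∃ᶠ a in l, a ∈ C i) → (D ∩ C i).Infinite := by
  obtain ⟨B, hB⟩ := l.exists_antitone_basis
  let J : Set ι := {i | ∃ᶠ a in l, a ∈ C i}
  obtain ⟨u, hu⟩ := exists_injective_nat (J × ℕ)
  have hmeet : ∀ p : J × ℕ, ∃ a ∈ C p.1, a ∈ B (u p) := fun p =>
    (p.1.2.and_eventually (hB.mem (u p))).exists
  choose s hsC hsB using hmeet
  have hs : Tendsto s cofinite l := fun S hS => by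
    have hev := hu.tendsto_cofinite.eventually
      (Nat.cofinite_eq_atTop ▸ hB.eventually_subset hS)
    exact hev.mono fun p hp => hp (hsB p)
  refine ⟨range s, (cofinite_inf_principal_range_le_map s).trans hs, fun i hi => ?_⟩
  have hrow : Tendsto (fun j => s (⟨i, hi⟩, j)) cofinite cofinite :=
    (hs.mono_right hl).comp (Prod.mk_right_injective _).tendsto_cofinite
  refine (infinite_range_of_tendsto_cofinite hrow).mono ?_
  rintro _ ⟨j, rfl⟩
  exact ⟨mem_range_self _, hsC (⟨i, hi⟩, j)⟩

theorem eventually_cofinite_prod {p : α × β → Prop} (hrow : ∀ᶠ i in cofinite, ∀ j, p (i, j))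
    (hcol : ∀ i, ∀ᶠ j in cofinite, p (i, j)) : ∀ᶠ x in cofinite, p x := by
  refine Finite.of_finite_fibers Prod.fst (Finite.subset hrow ?_) fun i _ =>
    ((hcol i).image (Prod.mk i)).subset ?_
  · rintro _ ⟨x, hx, rfl⟩ h
    exact hx (h x.2)
  · rintro ⟨_, j⟩ ⟨hx, rfl⟩
    exact ⟨j, hx, rfl⟩

end Filters

section Ideals

theorem mem_fin2Sets_iff {A : Set (ℕ × ℕ)} :
    A ∈ fin2Sets ↔ ∀ᶠ i in cofinite, {j | (i, j) ∈ A}.Finite := by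
  rw [Nat.cofinite_eq_atTop, eventually_atTop]
  rfl

theorem mem_biSets_iff {A : Set (ℕ × ℕ × ℕ)} :
    A ∈ biSets ↔ (∀ i, {p : ℕ × ℕ | (i, p) ∈ A} ∈ fin2Sets) ∧
      ∀ᶠ i in cofinite, {p : ℕ × ℕ | (i, p) ∈ A}.Finite := by
  rw [Nat.cofinite_eq_atTop, eventually_atTop]
  refine ⟨fun ⟨i₀, hlt, hge⟩ => ⟨fun i => ?_, i₀, hge⟩,
    fun ⟨h, i₀, hge⟩ => ⟨i₀, fun i _ => h i, hge⟩⟩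
  exact (lt_or_ge i i₀).elim (hlt i) fun hi => fin2Sets_finite _ (hge i hi)

theorem setOf_prodMk_mem_image {α β γ : Type*} {g : α → β} {e : α → γ} {D : Set α} {i : β} :
    {y | (i, y) ∈ (fun a => (g a, e a)) '' D} = e '' (D ∩ {a | g a = i}) := by
  ext y
  constructor
  · rintro ⟨a, haD, ha⟩
    exact ⟨a, ⟨haD, congrArg Prod.fst ha⟩, congrArg Prod.snd ha⟩
  · rintro ⟨a, ⟨haD, rfl⟩, rfl⟩
    exact ⟨a, haD, rfl⟩

theorem image_prodMk_mem_fin2Sets_iff {α : Type*} {g e : α → ℕ} {D : Set α}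
    (he : Function.Injective e) : (fun a => (g a, e a)) '' D ∈ fin2Sets ↔
      ∀ᶠ i in cofinite, (D ∩ {a | g a = i}).Finite := by
  simp only [mem_fin2Sets_iff, setOf_prodMk_mem_image, finite_image_iff he.injOn]

theorem image_prodMk_mem_biSets_iff {α : Type*} {g : α → ℕ × ℕ} {e : α → ℕ} {D : Set α}
    (he : Function.Injective e) : (fun a => ((g a).1, (g a).2, e a)) '' D ∈ biSets ↔
      (∀ i, ∀ᶠ j in cofinite, (D ∩ {a | g a = (i, j)}).Finite) ∧
        ∀ᶠ i in cofinite, (D ∩ {a | (g a).1 = i}).Finite := by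
  have hinj : Function.Injective fun a => ((g a).2, e a) := fun a b h =>
    he (congrArg Prod.snd h)
  simp only [mem_biSets_iff, setOf_prodMk_mem_image (e := fun a => ((g a).2, e a)),
    image_prodMk_mem_fin2Sets_iff he, finite_image_iff hinj.injOn, inter_assoc, ← ofPred_and,
    Prod.ext_iff]

theorem SetIdeal.mem_of_diff_mem {X : Type*} (I : SetIdeal X) {A D : Set X} (hA : A ∈ I.sets)
    (hDA : D \ A ∈ I.sets) : D ∈ I.sets :=
  I.subset_mem _ _ (sdiff_subset_iff.mp subset_rfl) (I.union_mem _ _ hA hDA)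

end Ideals

section BoringSpaces

/-- The limits of the one-to-one convergent sequences of `X`. A Hausdorff sequentially compact space
is boring precisely when there are only finitely many of them. -/
def injectiveLimits (X : Type*) [TopologicalSpace X] : Set X :=
  {x | ∃ s : ℕ → X, Function.Injective s ∧ Tendsto s atTop (𝓝 x)}

variable {X : Type*} [TopologicalSpace X]

theorem boringSpace_iff_finite_injectiveLimits [T2Space X] :
    BoringSpace X ↔ SeqCompactSpace X ∧ (injectiveLimits X).Finite := by
  refine and_congr_right fun _ => ⟨fun ⟨T, hT, hlim⟩ => hT.subset ?_,
    fun h => ⟨_, h, fun s hs ⟨x, hx⟩ => ⟨x, ⟨s, hs, hx⟩, hx⟩⟩⟩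
  rintro x ⟨s, hs, hx⟩
  obtain ⟨y, hy, hsy⟩ := hlim s hs ⟨x, hx⟩
  rwa [tendsto_nhds_unique hx hsy]

theorem BoringSpace.of_surjective {Y : Type*} [TopologicalSpace Y] [T2Space Y] {φ : X → Y}
    (hX : BoringSpace X) (hφ : Continuous φ) (hsurj : Function.Surjective φ) : BoringSpace Y := by
  obtain ⟨_, T, hT, hlim⟩ := hX
  have hlift (s : ℕ → Y) : ∃ t : ℕ → X, φ ∘ t = s :=
    ⟨fun n => Function.surjInv hsurj (s n), funext fun n => Function.surjInv_eq hsurj (s n)⟩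
  refine ⟨⟨fun s _ => ?_⟩, φ '' T, hT.image φ, fun s hs ⟨y, hy⟩ => ?_⟩
  all_goals
    obtain ⟨t, rfl⟩ := hlift s
    obtain ⟨x, k, hk, hx⟩ := SeqCompactSpace.tendsto_subseq t
  · exact ⟨φ x, mem_univ _, k, hk, (hφ.tendsto x).comp hx⟩
  · obtain ⟨z, hz, htz⟩ := hlim (t ∘ k) (hs.of_comp.comp hk.injective) ⟨x, hx⟩
    have hyz : y = φ z :=
      tendsto_nhds_unique (hy.comp hk.tendsto_atTop) ((hφ.tendsto z).comp htz)
    exact ⟨φ z, mem_image_of_mem φ hz, hyz ▸ hy⟩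

theorem boringSpace_ulift_iff [T2Space X] : BoringSpace (ULift.{u} X) ↔ BoringSpace X :=
  ⟨fun h => h.of_surjective continuous_uliftDown ULift.down_surjective,
    fun h => h.of_surjective continuous_uliftUp ULift.up_surjective⟩

theorem BoringSpace.of_cofinite_le_nhds [SeqCompactSpace X] {x : X} (hx : cofinite ≤ 𝓝 x) :
    BoringSpace X :=
  ⟨inferInstance, {x}, finite_singleton x, fun _ hs _ =>
    ⟨x, rfl, (Nat.cofinite_eq_atTop ▸ hs.tendsto_cofinite).mono_right hx⟩⟩

theorem BoringSpace.exists_finite_cofinite_le (hX : BoringSpace X) :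
    ∃ T : Set X, T.Finite ∧ cofinite ≤ ⨆ x ∈ T, 𝓝 x := by
  obtain ⟨_, T, hT, hlim⟩ := hX
  refine ⟨T, hT, fun S hS => not_infinite.mp fun hinf => ?_⟩
  simp only [mem_iSup] at hS
  let s : ℕ ↪ (Sᶜ : Set X) := hinf.natEmbedding
  obtain ⟨x, φ, hφ, hx⟩ := SeqCompactSpace.tendsto_subseq fun n => (s n : X)
  obtain ⟨y, hy, hsy⟩ := hlim _ (Subtype.val_injective.comp (s.injective.comp hφ.injective)) ⟨x, hx⟩
  obtain ⟨n, hn⟩ := (hsy.eventually (hS y hy)).exists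
  exact (s (φ n)).2 hn

theorem BoringSpace.exists_finite_cover [T2Space X] (hX : BoringSpace X) :
    ∃ (T : Set X) (U : X → Set X), T.Finite ∧ (⋃ x ∈ T, U x) ∈ cofinite ∧
      ∀ x ∈ T, cofinite ⊓ 𝓟 (U x) ≤ 𝓝 x := by
  obtain ⟨T, hT, hle⟩ := hX.exists_finite_cofinite_le
  obtain ⟨U, hU, hdisj⟩ := hT.t2_separation
  have hUnhds : ∀ x, U x ∈ 𝓝 x := fun x => (hU x).2.mem_nhds (hU x).1
  refine ⟨T, U, hT, hle ?_, fun x hx V hV => mem_inf_principal.mpr (hle ?_)⟩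
  · simp only [mem_iSup]
    exact fun x hx => mem_of_superset (hUnhds x) (subset_biUnion_of_mem hx)
  · simp only [mem_iSup]
    intro y hy
    obtain rfl | hyx := eq_or_ne y x
    · exact mem_of_superset hV fun z hz _ => hz
    · exact mem_of_superset (hUnhds y) fun z hzy hzx =>
        (disjoint_left.mp (hdisj hy hx hyx) hzy hzx).elim

theorem eventually_nhdsNE_notMem_range [T2Space X] {ι : Type*} {t : ι → X} {x y : X}
    (ht : Tendsto t cofinite (𝓝 x)) (hxy : x ≠ y) : ∀ᶠ z in 𝓝[≠] y, z ∉ range t := by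
  have hrange : cofinite ⊓ 𝓟 (range t) ≤ 𝓝 x := (cofinite_inf_principal_range_le_map t).trans ht
  have hdisj : 𝓝[≠] y ⊓ 𝓟 (range t) = ⊥ := le_bot_iff.mp <| calc
    𝓝[≠] y ⊓ 𝓟 (range t) ≤ 𝓝 y ⊓ (cofinite ⊓ 𝓟 (range t)) :=
      le_inf (inf_le_left.trans nhdsWithin_le_nhds) (inf_le_inf_right _ (nhdsNE_le_cofinite y))
    _ ≤ 𝓝 y ⊓ 𝓝 x := inf_le_inf_left _ hrange
    _ = ⊥ := (disjoint_nhds_nhds.mpr hxy.symm).eq_bot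
  exact inf_principal_eq_bot.mp hdisj

theorem exists_injective_prod_tendsto [T2Space X] (h : (injectiveLimits X).Infinite) :
    ∃ (x : ℕ → X) (s : ℕ × ℕ → X), Function.Injective x ∧ Function.Injective s ∧
      ∀ i, Tendsto (fun j => s (i, j)) cofinite (𝓝 (x i)) := by
  let x : ℕ → X := fun i => h.natEmbedding _ i
  have hx : Function.Injective x := Subtype.val_injective.comp (h.natEmbedding _).injective
  choose t ht htx using fun i => (h.natEmbedding _ i).2
  have htcof : ∀ i, Tendsto (t i) cofinite (𝓝 (x i)) := Nat.cofinite_eq_atTop ▸ htx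
  have havoid : ∀ i, ∀ᶠ m in atTop, ∀ k ∈ Iio i, t i m ∉ range (t k) := fun i => by
    have hne : Tendsto (t i) atTop (𝓝[≠] (x i)) := tendsto_nhdsWithin_iff.mpr
      ⟨htx i, Nat.cofinite_eq_atTop ▸ (ht i).tendsto_cofinite.eventually (eventually_cofinite_ne _)⟩
    exact (eventually_all_finite (finite_Iio i)).mpr fun k hk =>
      hne.eventually (eventually_nhdsNE_notMem_range (htcof k) (hx.ne (ne_of_lt hk)))
  choose N hN using fun i => eventually_atTop.mp (havoid i)
  have hrows {i j i' j' : ℕ} (h : t i (j + N i) = t i' (j' + N i')) : i' ≤ i :=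
    not_lt.mp fun hlt => hN i' _ (Nat.le_add_left _ j') i hlt ⟨_, h⟩
  refine ⟨x, fun p => t p.1 (p.2 + N p.1), hx, ?_, fun i =>
    (htcof i).comp (add_left_injective (N i)).tendsto_cofinite⟩
  rintro ⟨i, j⟩ ⟨i', j'⟩ hp
  obtain rfl : i = i' := le_antisymm (hrows hp.symm) (hrows hp)
  exact congrArg (Prod.mk i) (Nat.add_right_cancel (ht i hp))

end BoringSpaces

section TestSpaces

theorem cofinite_le_nhds_top : cofinite ≤ 𝓝 (⊤ : ℕ∞) := by
  refine tendsto_id'.mp (ENat.tendsto_nhds_top_iff_natCast_lt.mpr fun n => ?_)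
  have hfin : (Iic (n : ℕ∞)).Finite := by
    refine ((finite_Iic n).image ((↑) : ℕ → ℕ∞)).subset fun x hx => ?_
    lift x to ℕ using ne_top_of_le_ne_top (ENat.natCast_ne_top n) hx
    exact ⟨x, ENat.natCast_le_natCast.mp hx, rfl⟩
  filter_upwards [hfin.compl_mem_cofinite] with x hx using not_le.mp hx

theorem boringSpace_enat : BoringSpace ℕ∞ := .of_cofinite_le_nhds cofinite_le_nhds_top

/-- The row `{i} × Y` of the one-point compactification of `ι × Y`. -/
def onePointRow (Y : Type*) {ι : Type*} (i : ι) : Set (OnePoint (ι × Y)) :=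
  range fun y : Y => ((i, y) : OnePoint (ι × Y))

variable {ι Y : Type*} [TopologicalSpace ι] [TopologicalSpace Y]

theorem cofinite_inf_onePointRow_le_nhds {y : Y} (hy : cofinite ≤ 𝓝 y) (i : ι) :
    cofinite ⊓ 𝓟 (onePointRow Y i) ≤ 𝓝 ((i, y) : OnePoint (ι × Y)) :=
  (cofinite_inf_principal_range_le_map _).trans <| (map_mono hy).trans
    (OnePoint.continuous_coe.comp (Continuous.prodMk_right i)).continuousAt

theorem le_nhds_infty_of_forall_notMem_onePointRow [DiscreteTopology ι]
    {l : Filter (OnePoint (ι × Y))} (h : ∀ i, ∀ᶠ x in l, x ∉ onePointRow Y i) :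
    l ≤ 𝓝 OnePoint.infty := by
  refine OnePoint.le_nhds_infty.mpr fun C _ hC => ?_
  have hfin : (Prod.fst '' C).Finite := (hC.image continuous_fst).finite_of_discrete
  filter_upwards [(eventually_all_finite hfin).mpr fun i _ => h i] with x hx
  induction x using OnePoint.rec with
  | infty => exact .inr rfl
  | coe p => exact .inl ⟨p, fun hp => hx p.1 (mem_image_of_mem _ hp) ⟨p.2, rfl⟩, rfl⟩

theorem not_boringSpace_onePoint : ¬ BoringSpace (OnePoint (ℕ × ℕ∞)) := by
  have hinj : Function.Injective fun i : ℕ => (((i, ⊤) : ℕ × ℕ∞) : OnePoint (ℕ × ℕ∞)) :=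
    OnePoint.coe_injective.comp (Prod.mk_left_injective _)
  refine fun h => infinite_range_of_injective hinj
    ((boringSpace_iff_finite_injectiveLimits.mp h).2.subset ?_)
  rintro _ ⟨i, rfl⟩
  exact ⟨fun j : ℕ => ((i, (j : ℕ∞)) : OnePoint (ℕ × ℕ∞)),
    OnePoint.coe_injective.comp ((Prod.mk_right_injective i).comp Nat.cast_injective),
    (OnePoint.continuous_coe.comp (Continuous.prodMk_right i)).continuousAt.tendsto.comp
      ENat.tendsto_natCast_nhds_top⟩

end TestSpaces

namespace PartitionRegular

variable {Ω Λ Ω' Λ' : Type*} {ρ : PartitionRegular Ω Λ} {E F : Set Ω}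

section Tails

theorem empty_mem_ideal (ρ : PartitionRegular Ω Λ) : ∅ ∈ ρ.ideal := fun F hF h =>
  ρ.infinite_toFun F hF (finite_empty.subset h)

theorem mem_ideal_of_subset {A B : Set Λ} (hB : B ∈ ρ.ideal) (h : A ⊆ B) : A ∈ ρ.ideal :=
  fun F hF hFA => hB F hF (hFA.trans h)

theorem union_mem_ideal {A B : Set Λ} (hA : A ∈ ρ.ideal) (hB : B ∈ ρ.ideal) :
    A ∪ B ∈ ρ.ideal := by
  intro F hF hFAB
  obtain ⟨E, hE, hEA | hEB⟩ := ρ.regular F hF (ρ.toFun F ∩ A) (ρ.toFun F ∩ B) (by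
    rw [← inter_union_distrib_left, inter_eq_left.mpr hFAB])
  · exact hA E hE (hEA.trans inter_subset_right)
  · exact hB E hE (hEB.trans inter_subset_right)

/-- The filter dual to the ideal `I_ρ`: thus `∀ᶠ a in ρ.dualFilter, p a` says that `p` fails only on
a set from `I_ρ`, and `∃ᶠ a in ρ.dualFilter, p a` that `p` holds on a positive set. -/
def dualFilter (ρ : PartitionRegular Ω Λ) : Filter Λ :=
  comk (· ∈ ρ.ideal) ρ.empty_mem_ideal (fun _ hB _ h => mem_ideal_of_subset hB h)
    fun _ hA _ hB => union_mem_ideal hA hB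

theorem mem_dualFilter {A : Set Λ} : A ∈ ρ.dualFilter ↔ Aᶜ ∈ ρ.ideal := Iff.rfl

theorem compl_mem_dualFilter {A : Set Λ} : Aᶜ ∈ ρ.dualFilter ↔ A ∈ ρ.ideal := compl_mem_comk

theorem frequently_dualFilter_iff_notMem_ideal {A : Set Λ} :
    (∃ᶠ a in ρ.dualFilter, a ∈ A) ↔ A ∉ ρ.ideal :=
  not_congr compl_mem_dualFilter

theorem frequently_dualFilter_iff_exists {A : Set Λ} :
    (∃ᶠ a in ρ.dualFilter, a ∈ A) ↔ ∃ F ∈ ρ.dom, ρ.toFun F ⊆ A := by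
  simp only [frequently_dualFilter_iff_notMem_ideal, ideal, mem_ofPred_eq, not_forall, not_not,
    exists_prop]

theorem tendsto_dualFilter_cofinite_iff {Y : Type*} {f : Λ → Y} :
    Tendsto f ρ.dualFilter cofinite ↔ ∀ y, f ⁻¹' {y} ∈ ρ.ideal :=
  tendsto_cofinite_iff_eventually_ne.trans (forall_congr' fun _ => compl_mem_dualFilter)

/-- The filter generated by the sets `ρ(F \ K)` for finite `K`. It encodes all the convergence
notions for `ρ` when `F ∈ ρ.dom`; only then do these sets form a base of it. -/
def tail (ρ : PartitionRegular Ω Λ) (F : Set Ω) : Filter Λ :=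
  ⨅ K : Finset Ω, 𝓟 (ρ.toFun (F \ K))

instance [Countable Ω] : (ρ.tail F).IsCountablyGenerated :=
  inferInstanceAs (⨅ K : Finset Ω, 𝓟 (ρ.toFun (F \ K))).IsCountablyGenerated

theorem hasBasis_tail (hF : F ∈ ρ.dom) :
    (ρ.tail F).HasBasis (fun _ => True) fun K : Finset Ω => ρ.toFun (F \ K) := by
  classical
  have hanti {K L : Finset Ω} (h : K ⊆ L) : ρ.toFun (F \ L) ⊆ ρ.toFun (F \ K) :=
    ρ.mono _ (ρ.diff_mem_dom F hF L) _ (ρ.diff_mem_dom F hF K)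
      (sdiff_subset_sdiff_right (Finset.coe_subset.mpr h))
  exact hasBasis_iInf_principal fun K L =>
    ⟨K ∪ L, hanti Finset.subset_union_left, hanti Finset.subset_union_right⟩

theorem mem_tail_iff (hF : F ∈ ρ.dom) {A : Set Λ} :
    A ∈ ρ.tail F ↔ ∃ K : Finset Ω, ρ.toFun (F \ K) ⊆ A := by
  simp only [(hasBasis_tail hF).mem_iff, true_and]

theorem tail_neBot (hF : F ∈ ρ.dom) : (ρ.tail F).NeBot :=
  (hasBasis_tail hF).neBot_iff.mpr fun {K} _ =>
    (ρ.infinite_toFun _ (ρ.diff_mem_dom F hF K)).nonempty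

theorem toFun_mem_tail (hF : F ∈ ρ.dom) : ρ.toFun F ∈ ρ.tail F :=
  (mem_tail_iff hF).mpr ⟨∅, by simp only [Finset.coe_empty, sdiff_empty, subset_rfl]⟩

theorem tail_mono (hE : E ∈ ρ.dom) (hF : F ∈ ρ.dom) (h : E ⊆ F) : ρ.tail E ≤ ρ.tail F :=
  iInf_mono fun K => principal_mono.mpr <|
    ρ.mono _ (ρ.diff_mem_dom E hE K) _ (ρ.diff_mem_dom F hF K) (sdiff_subset_sdiff_left h)

theorem tail_le_tail_iff {ρ' : PartitionRegular Ω' Λ} {F' : Set Ω'} (hF : F ∈ ρ.dom)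
    (hF' : F' ∈ ρ'.dom) : ρ.tail F ≤ ρ'.tail F' ↔
      ∀ K' : Finset Ω', ∃ K : Finset Ω, ρ.toFun (F \ K) ⊆ ρ'.toFun (F' \ K') := by
  simp only [(hasBasis_tail hF).le_basis_iff (hasBasis_tail hF'), true_and, forall_const]

theorem frequently_dualFilter_of_mem_tail (hF : F ∈ ρ.dom) {A : Set Λ} (hA : A ∈ ρ.tail F) :
    ∃ᶠ a in ρ.dualFilter, a ∈ A := by
  obtain ⟨K, hK⟩ := (mem_tail_iff hF).mp hA
  exact frequently_dualFilter_iff_exists.mpr ⟨_, ρ.diff_mem_dom F hF K, hK⟩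

theorem convergesTo_iff_tendsto {X : Type*} [TopologicalSpace X] {f : Λ → X} {x : X}
    (hF : F ∈ ρ.dom) : ρ.ConvergesTo f F x ↔ Tendsto f (ρ.tail F) (𝓝 x) := by
  simp only [ConvergesTo, tendsto_def, mem_tail_iff hF, image_subset_iff]

theorem finBW_iff_tendsto {X : Type*} [TopologicalSpace X] :
    ρ.FinBW X ↔ ∀ f : Λ → X, ∃ F ∈ ρ.dom, ∃ x, Tendsto f (ρ.tail F) (𝓝 x) :=
  forall_congr' fun _ => exists_congr fun _ => and_congr_right fun hF =>
    exists_congr fun _ => convergesTo_iff_tendsto hF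

theorem katetovLE_iff_tail_le_map {ρ' : PartitionRegular Ω' Λ'} :
    KatetovLE ρ' ρ ↔
      ∃ f : Λ → Λ', ∀ F ∈ ρ.dom, ∃ F' ∈ ρ'.dom, ρ'.tail F' ≤ map f (ρ.tail F) := by
  refine exists_congr fun f => forall₂_congr fun F hF => exists_congr fun F' =>
    and_congr_right fun hF' => ?_
  simp only [(hasBasis_tail hF').le_basis_iff ((hasBasis_tail hF).map f), true_and, forall_const]

theorem tail_rho {X : Type*} {I : SetIdeal X} {D : Set X} (hD : D ∉ I.sets) :
    I.rho.tail D = cofinite ⊓ 𝓟 D := by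
  ext S
  rw [mem_tail_iff (ρ := I.rho) hD, mem_cofinite_inf_principal_iff]
  refine ⟨fun ⟨K, hK⟩ => K.finite_toSet.subset (sdiff_subset_comm.mp hK), fun h => ?_⟩
  refine ⟨h.toFinset, ?_⟩
  rw [h.coe_toFinset]
  exact sdiff_subset_comm.mp subset_rfl

theorem katetovLE_rho_iff {X : Type*} {I : SetIdeal X} :
    KatetovLE I.rho ρ ↔
      ∃ f : Λ → X, ∀ F ∈ ρ.dom, ∃ D ∉ I.sets, cofinite ⊓ 𝓟 D ≤ map f (ρ.tail F) := by
  refine katetovLE_iff_tail_le_map.trans <| exists_congr fun f => forall₂_congr fun F _ =>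
    exists_congr fun D => and_congr_right fun hD => ?_
  rw [tail_rho hD]

theorem eventually_notMem_of_forall_le_map {X : Type*} {I : SetIdeal X} {f : Λ → X}
    (hf : ∀ F ∈ ρ.dom, ∃ D ∉ I.sets, cofinite ⊓ 𝓟 D ≤ map f (ρ.tail F)) {A : Set X}
    (hA : A ∈ I.sets) : ∀ᶠ a in ρ.dualFilter, f a ∉ A := by
  by_contra hpos
  rw [not_eventually, frequently_congr (.of_forall fun _ => not_not)] at hpos
  obtain ⟨F, hF, hFA⟩ := (frequently_dualFilter_iff_exists (A := f ⁻¹' A)).mp hpos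
  obtain ⟨D, hD, hle⟩ := hf F hF
  have hfA : f ⁻¹' A ∈ ρ.tail F := mem_of_superset (toFun_mem_tail hF) hFA
  have hDA : A ∈ cofinite ⊓ 𝓟 D := hle hfA
  exact hD (I.mem_of_diff_mem hA (I.finite_mem _ (mem_cofinite_inf_principal_iff.mp hDA)))

end Tails

section Refinable

/-- `F` is refinable if every positive subset `B` of `ρ(F)` supports a tail filter finer than that
of `F`. Condition `(S₂)` says that every member of the domain contains a refinable one. -/
def IsRefinable (ρ : PartitionRegular Ω Λ) (F : Set Ω) : Prop :=
  ∀ B : Set Λ, (∃ᶠ a in ρ.dualFilter, a ∈ ρ.toFun F ∩ B) →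
    ∃ G ∈ ρ.dom, ρ.tail G ≤ ρ.tail F ⊓ 𝓟 B

theorem exists_tail_le_cofinite (hE : E ∈ ρ.dom) :
    ∃ F ∈ ρ.dom, F ⊆ E ∧ ρ.tail F ≤ cofinite := by
  obtain ⟨F, hF, hFE, hsparse⟩ := ρ.sparse E hE
  refine ⟨F, hF, hFE, le_cofinite_iff_eventually_ne.mpr fun a => ?_⟩
  by_cases ha : a ∈ ρ.toFun F
  · obtain ⟨K, hK⟩ := hsparse a ha
    exact (mem_tail_iff hF).mpr ⟨K, fun b hb hba => hK (hba ▸ hb)⟩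
  · exact mem_of_superset (toFun_mem_tail hF) fun b hb hba => ha (hba ▸ hb)

theorem S2.exists_isRefinable (hρ : ρ.S2) (hE : E ∈ ρ.dom) :
    ∃ F ∈ ρ.dom, ρ.tail F ≤ ρ.tail E ∧ ρ.tail F ≤ cofinite ∧ ρ.IsRefinable F := by
  obtain ⟨E', hE', hE'E, hcof⟩ := exists_tail_le_cofinite hE
  obtain ⟨F, hF, hFE', hS2⟩ := hρ E' hE'
  have hle : ρ.tail F ≤ ρ.tail E' := tail_mono hF hE' hFE'
  refine ⟨F, hF, hle.trans (tail_mono hE' hE hE'E), hle.trans hcof, fun B hB => ?_⟩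
  obtain ⟨G, hG, hGB, hGF⟩ :=
    hS2 (ρ.toFun F ∩ B) (frequently_dualFilter_iff_notMem_ideal.mp hB) inter_subset_left
  exact ⟨G, hG, le_inf ((tail_le_tail_iff hG hF).mpr hGF)
    (le_principal_iff.mpr (mem_of_superset (toFun_mem_tail hG) (hGB.trans inter_subset_right)))⟩

namespace IsRefinable

theorem exists_of_mem_dualFilter (hFr : ρ.IsRefinable F) (hF : F ∈ ρ.dom) {A : Set Λ}
    (hA : A ∈ ρ.dualFilter) : ∃ G ∈ ρ.dom, ρ.tail G ≤ ρ.tail F ⊓ 𝓟 A :=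
  hFr A ((frequently_dualFilter_of_mem_tail hF (toFun_mem_tail hF)).and_eventually hA)

theorem exists_of_eventually_exists {ι : Type*} {T : Set ι} (hFr : ρ.IsRefinable F)
    (hF : F ∈ ρ.dom) (hT : T.Finite) {B : ι → Set Λ}
    (hB : ∀ᶠ a in ρ.dualFilter, ∃ i ∈ T, a ∈ B i) :
    ∃ i ∈ T, ∃ G ∈ ρ.dom, ρ.tail G ≤ ρ.tail F ⊓ 𝓟 (B i) := by
  have hpos : ∃ᶠ a in ρ.dualFilter, ∃ i ∈ T, a ∈ ρ.toFun F ∩ B i :=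
    ((frequently_dualFilter_of_mem_tail hF (toFun_mem_tail hF)).and_eventually hB).mono
      fun _ ⟨haF, i, hi, haB⟩ => ⟨i, hi, haF, haB⟩
  obtain ⟨i, hi, hposi⟩ := (frequently_exists_finite hT).mp hpos
  exact ⟨i, hi, hFr _ hposi⟩

theorem exists_tendsto_cofinite {Y : Type*} {g : Λ → Y} (hFr : ρ.IsRefinable F)
    (hF : F ∈ ρ.dom) (hg : Tendsto g ρ.dualFilter cofinite)
    (hev : ∀ᶠ y in cofinite, ∀ᶠ a in ρ.tail F, g a ≠ y) :
    ∃ G ∈ ρ.dom, ρ.tail G ≤ ρ.tail F ∧ Tendsto g (ρ.tail G) cofinite := by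
  obtain ⟨G, hG, hle⟩ := hFr.exists_of_mem_dualFilter hF (hg (show _ ∈ cofinite from hev))
  refine ⟨G, hG, hle.trans inf_le_left, tendsto_cofinite_iff_eventually_ne.mpr fun y => ?_⟩
  by_cases hy : ∀ᶠ a in ρ.tail F, g a ≠ y
  · exact hy.filter_mono (hle.trans inf_le_left)
  · refine Eventually.filter_mono (hle.trans inf_le_right) (eventually_principal.mpr ?_)
    rintro a ha rfl
    exact hy ha

end IsRefinable

end Refinable

section PProperties

theorem p1Minus_iff_forall_mem_dualFilter : ρ.P1Minus ↔
    ∀ A : ℕ → Set Λ, (∀ n, A n ∈ ρ.dualFilter) → ∃ F ∈ ρ.dom, ∀ n, A n ∈ ρ.tail F := by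
  refine ⟨fun h A hA => ?_, fun h A h0 _ hdiff => ?_⟩
  · obtain ⟨F, hF, hFA⟩ := h (fun n => {a | ∀ k < n, a ∈ A k})
      (eq_univ_of_forall fun a k hk => absurd hk k.not_lt_zero)
      (fun n a ha k hk => ha k (hk.trans n.lt_succ_self)) fun n =>
        mem_ideal_of_subset (mem_dualFilter.mp (hA n)) fun a ⟨hlt, hnot⟩ han =>
          hnot fun k hk => (Nat.lt_succ_iff_lt_or_eq.mp hk).elim (hlt k) fun h => h ▸ han
    exact ⟨F, hF, fun n => mem_of_superset ((mem_tail_iff hF).mpr (hFA (n + 1)))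
      fun a ha => ha n n.lt_succ_self⟩
  · have hmem : ∀ n, A n ∈ ρ.dualFilter := fun n => by
      induction n with
      | zero => exact h0 ▸ univ_mem
      | succ n ih =>
        filter_upwards [ih, compl_mem_dualFilter.mpr (hdiff n)] with a ha hna
        exact not_not.mp fun hsucc => hna ⟨ha, hsucc⟩
    obtain ⟨F, hF, hFA⟩ := h A hmem
    exact ⟨F, hF, fun n => (mem_tail_iff hF).mp (hFA n)⟩

theorem p1Minus_iff : ρ.P1Minus ↔ ∀ g : Λ → ℕ, Tendsto g ρ.dualFilter cofinite →
    ∃ F ∈ ρ.dom, Tendsto g (ρ.tail F) cofinite := by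
  rw [p1Minus_iff_forall_mem_dualFilter]
  simp only [tendsto_cofinite_iff_eventually_ne]
  refine ⟨fun h g hg => h (fun n => {a | g a ≠ n}) hg, fun h A hA => ?_⟩
  by_cases hpos : ∃ᶠ a in ρ.dualFilter, a ∈ ⋂ n, A n
  · obtain ⟨F, hF, hFA⟩ := frequently_dualFilter_iff_exists.mp hpos
    exact ⟨F, hF, fun n => mem_of_superset (toFun_mem_tail hF) (hFA.trans (iInter_subset _ n))⟩
  · let g : Λ → ℕ := fun a => sInf {n | a ∉ A n}
    have hg : ∀ n, ∀ᶠ a in ρ.dualFilter, g a ≠ n := fun n => by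
      filter_upwards [not_frequently.mp hpos, hA n] with a ha han
      have hne : {k | a ∉ A k}.Nonempty := not_forall.mp (mt mem_iInter.mpr ha)
      rintro rfl
      exact Nat.sInf_mem hne han
    obtain ⟨F, hF, hgF⟩ := h g hg
    refine ⟨F, hF, fun n => ?_⟩
    filter_upwards [(eventually_all_finite (finite_Iic n)).mpr fun k _ => hgF k] with a ha
    by_contra han
    exact ha (g a) (Nat.sInf_le han) rfl

theorem P1Minus.exists_tendsto_cofinite [Countable Λ] (hP : ρ.P1Minus) {Y : Type*} {f : Λ → Y}
    (hf : Tendsto f ρ.dualFilter cofinite) :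
    ∃ F ∈ ρ.dom, Tendsto f (ρ.tail F) cofinite := by
  obtain ⟨c, hc⟩ := countable_iff_exists_injOn.mp (countable_range f)
  obtain ⟨F, hF, hcf⟩ := p1Minus_iff.mp hP (c ∘ f) ((tendsto_comp_cofinite_iff_of_injOn hc).mpr hf)
  exact ⟨F, hF, (tendsto_comp_cofinite_iff_of_injOn hc).mp hcf⟩

theorem exists_toFun_inter_eq_empty_iff (hF : F ∈ ρ.dom) {A : Set Λ} :
    (∃ K : Finset Ω, ρ.toFun (F \ K) ∩ A = ∅) ↔ ∀ᶠ a in ρ.tail F, a ∉ A := by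
  simp only [← disjoint_iff_inter_eq_empty, ← subset_compl_iff_disjoint_right, ← mem_tail_iff hF]
  rfl

theorem p2Minus_iff : ρ.P2Minus ↔ ∀ g : Λ → ℕ × ℕ, Tendsto g ρ.dualFilter cofinite →
    ∃ F ∈ ρ.dom, Tendsto g (ρ.tail F) cofinite ∧
      ∀ᶠ i in cofinite, ∀ᶠ a in ρ.tail F, (g a).1 ≠ i := by
  have hcond {A : ℕ → ℕ → Set Λ} {g : Λ → ℕ × ℕ} (hg : ∀ a i j, a ∈ A i j ↔ g a = (i, j))
      {F : Set Ω} (hF : F ∈ ρ.dom) :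
      ((∀ i j, ∃ K : Finset Ω, ρ.toFun (F \ K) ∩ A i j = ∅) ∧
        ∃ i₀, ∀ i > i₀, ∃ K : Finset Ω, ρ.toFun (F \ K) ∩ ⋃ j, A i j = ∅) ↔
      Tendsto g (ρ.tail F) cofinite ∧
        ∀ᶠ i in cofinite, ∀ᶠ a in ρ.tail F, (g a).1 ≠ i := by
    have hrow : ∀ a i, a ∈ ⋃ j, A i j ↔ (g a).1 = i := fun a i => by
      simp only [mem_iUnion, hg, Prod.ext_iff, exists_and_left, exists_eq', and_true]
    simp only [exists_toFun_inter_eq_empty_iff hF, hg, hrow, tendsto_cofinite_iff_eventually_ne,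
      Prod.forall, Nat.cofinite_eq_atTop, atTop_basis_Ioi.eventually_iff, true_and]
    rfl
  refine ⟨fun h g hg => ?_, fun h A hdisj hcover hnull => ?_⟩
  · obtain ⟨F, hF, hFg⟩ := h (fun i j => g ⁻¹' {(i, j)})
      (fun i j i' j' hne => Disjoint.preimage g (disjoint_singleton.mpr hne))
      (eq_univ_of_forall fun a => mem_iUnion₂.mpr ⟨(g a).1, (g a).2, rfl⟩)
      (fun i j => tendsto_dualFilter_cofinite_iff.mp hg (i, j))
    exact ⟨F, hF, (hcond (fun _ _ _ => Iff.rfl) hF).mp hFg⟩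
  · have hex : ∀ a, ∃ p : ℕ × ℕ, a ∈ A p.1 p.2 := fun a => by
      obtain ⟨i, j, h⟩ := mem_iUnion₂.mp (hcover ▸ mem_univ a)
      exact ⟨(i, j), h⟩
    choose g hgA using hex
    have hg : ∀ a i j, a ∈ A i j ↔ g a = (i, j) := fun a i j => by
      refine ⟨fun h => ?_, fun h => ?_⟩
      · by_contra hne
        exact disjoint_left.mp (hdisj _ _ _ _ hne) (hgA a) h
      · simpa only [h] using hgA a
    obtain ⟨F, hF, hFg⟩ := h g (tendsto_dualFilter_cofinite_iff.mpr fun p =>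
      mem_ideal_of_subset (hnull p.1 p.2) fun a ha => (hg a _ _).mpr ha)
    exact ⟨F, hF, (hcond hg hF).mpr hFg⟩

theorem P2Minus.exists_tendsto_cofinite [Countable Λ] (hP : ρ.P2Minus) {Y : Type*} {f : Λ → Y}
    (hf : Tendsto f ρ.dualFilter cofinite) (r : Y → ℕ) :
    ∃ F ∈ ρ.dom, Tendsto f (ρ.tail F) cofinite ∧
      ∀ᶠ i in cofinite, ∀ᶠ a in ρ.tail F, r (f a) ≠ i := by
  obtain ⟨c, hc⟩ := countable_iff_exists_injOn.mp (countable_range f)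
  have hrc : InjOn (fun y => (r y, c y)) (range f) := fun y hy z hz h =>
    hc hy hz (congrArg Prod.snd h)
  obtain ⟨F, hF, hcf, hrow⟩ := p2Minus_iff.mp hP ((fun y => (r y, c y)) ∘ f)
    ((tendsto_comp_cofinite_iff_of_injOn hrc).mpr hf)
  exact ⟨F, hF, (tendsto_comp_cofinite_iff_of_injOn hrc).mp hcf, hrow⟩

end PProperties

section Katetov

theorem not_p1Minus_of_katetovLE (h : KatetovLE idealFIN2.rho ρ) : ¬ ρ.P1Minus := by
  intro hP
  obtain ⟨f, hf⟩ := katetovLE_rho_iff.mp h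
  obtain ⟨F, hF, htendsto⟩ := p1Minus_iff.mp hP (fun a => (f a).1) <|
    tendsto_cofinite_iff_eventually_ne.mpr fun n =>
      eventually_notMem_of_forall_le_map hf (A := {p | p.1 = n}) <| mem_fin2Sets_iff.mpr <|
        (eventually_cofinite_ne n).mono fun i hi => by
          simp only [mem_ofPred_eq, hi, ofPred_false, finite_empty]
  obtain ⟨D, hD, hle⟩ := hf F hF
  refine hD (mem_fin2Sets_iff.mpr (.of_forall fun i => ?_))
  have hfin : (D ∩ {p | p.1 = i}).Finite := finite_inter_of_cofinite_inf_principal_le_map hle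
    (tendsto_cofinite_iff_eventually_ne.mp htendsto i)
  exact (hfin.preimage (Prod.mk_right_injective i).injOn).subset fun j hj => ⟨hj, rfl⟩

theorem not_p2Minus_of_katetovLE (h : KatetovLE idealBI.rho ρ) : ¬ ρ.P2Minus := by
  intro hP
  obtain ⟨f, hf⟩ := katetovLE_rho_iff.mp h
  obtain ⟨F, hF, htendsto, hrow⟩ := p2Minus_iff.mp hP (fun a => ((f a).1, (f a).2.1)) <|
    tendsto_cofinite_iff_eventually_ne.mpr fun p =>
      eventually_notMem_of_forall_le_map hf (A := {q | (q.1, q.2.1) = p}) <|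
        mem_biSets_iff.mpr
          ⟨fun i => mem_fin2Sets_iff.mpr <| (eventually_cofinite_ne p.2).mono fun j hj => by
            simp [Prod.ext_iff, hj],
          (eventually_cofinite_ne p.1).mono fun i hi => by simp [Prod.ext_iff, hi]⟩
  obtain ⟨D, hD, hle⟩ := hf F hF
  refine hD (mem_biSets_iff.mpr ⟨fun i => mem_fin2Sets_iff.mpr (.of_forall fun j => ?_),
    hrow.mono fun i hi => ?_⟩)
  · have hfin : (D ∩ {q | (q.1, q.2.1) = (i, j)}).Finite :=
      finite_inter_of_cofinite_inf_principal_le_map hle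
        (tendsto_cofinite_iff_eventually_ne.mp htendsto (i, j))
    have hinj : Function.Injective fun k : ℕ => (i, j, k) :=
      (Prod.mk_right_injective i).comp (Prod.mk_right_injective j)
    exact (hfin.preimage hinj.injOn).subset fun k hk => ⟨hk, rfl⟩
  · have hfin : (D ∩ {q | q.1 = i}).Finite :=
      finite_inter_of_cofinite_inf_principal_le_map hle hi
    exact (hfin.preimage (Prod.mk_right_injective i).injOn).subset fun p hp => ⟨hp, rfl⟩

theorem S2.katetovLE_rho_of_forall_isRefinable (hρ : ρ.S2) {X : Type*} {I : SetIdeal X}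
    (f : Λ → X) (h : ∀ F ∈ ρ.dom, ρ.tail F ≤ cofinite → ρ.IsRefinable F →
      ∃ D, f '' D ∉ I.sets ∧ cofinite ⊓ 𝓟 D ≤ ρ.tail F) : KatetovLE I.rho ρ := by
  refine katetovLE_rho_iff.mpr ⟨f, fun E hE => ?_⟩
  obtain ⟨F, hF, hFE, hcof, href⟩ := hρ.exists_isRefinable hE
  obtain ⟨D, hD, hDF⟩ := h F hF hcof href
  exact ⟨f '' D, hD,
    (cofinite_inf_principal_image_le_map f D).trans (map_mono (hDF.trans hFE))⟩

theorem S2.katetovLE_fin2_iff [Countable Ω] [Countable Λ] (hρ : ρ.S2) :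
    KatetovLE idealFIN2.rho ρ ↔ ¬ ρ.P1Minus := by
  refine ⟨not_p1Minus_of_katetovLE, fun hP => ?_⟩
  rw [p1Minus_iff] at hP
  push Not at hP
  obtain ⟨g, hg, hno⟩ := hP
  obtain ⟨e, he⟩ := exists_injective_nat Λ
  refine hρ.katetovLE_rho_of_forall_isRefinable (fun a => (g a, e a)) fun F hF hcof href => ?_
  obtain ⟨D, hDF, hD⟩ := exists_pseudoIntersection hcof fun i => {a | g a = i}
  refine ⟨D, fun hmem => ?_, hDF⟩
  have hev : ∀ᶠ i in cofinite, ∀ᶠ a in ρ.tail F, g a ≠ i :=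
    ((image_prodMk_mem_fin2Sets_iff he).mp hmem).mono fun i hfin =>
      not_frequently.mp fun hfreq => hD i hfreq hfin
  obtain ⟨G, hG, -, htendsto⟩ := href.exists_tendsto_cofinite hF hg hev
  exact hno G hG htendsto

theorem IsRefinable.exists_tendsto_cofinite_prod {ι κ : Type*} {g : Λ → ι × κ}
    (hFr : ρ.IsRefinable F) (hF : F ∈ ρ.dom) (hg : Tendsto g ρ.dualFilter cofinite)
    (hrow : ∀ᶠ i in cofinite, ∀ᶠ a in ρ.tail F, (g a).1 ≠ i)
    (hcol : ∀ i, ∀ᶠ j in cofinite, ∀ᶠ a in ρ.tail F, g a ≠ (i, j)) :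
    ∃ G ∈ ρ.dom, Tendsto g (ρ.tail G) cofinite ∧
      ∀ᶠ i in cofinite, ∀ᶠ a in ρ.tail G, (g a).1 ≠ i := by
  have hentry : ∀ᶠ i in cofinite, ∀ j, ∀ᶠ a in ρ.tail F, g a ≠ (i, j) :=
    hrow.mono fun i hi j => hi.mono fun a ha h => ha (congrArg Prod.fst h)
  obtain ⟨G, hG, hGF, htendsto⟩ :=
    hFr.exists_tendsto_cofinite hF hg (eventually_cofinite_prod hentry hcol)
  exact ⟨G, hG, htendsto, hrow.mono fun i hi => hi.filter_mono hGF⟩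

theorem S2.katetovLE_bi_iff [Countable Ω] [Countable Λ] (hρ : ρ.S2) :
    KatetovLE idealBI.rho ρ ↔ ¬ ρ.P2Minus := by
  refine ⟨not_p2Minus_of_katetovLE, fun hP => ?_⟩
  rw [p2Minus_iff] at hP
  push Not at hP
  obtain ⟨g, hg, hno⟩ := hP
  obtain ⟨e, he⟩ := exists_injective_nat Λ
  refine hρ.katetovLE_rho_of_forall_isRefinable (fun a => ((g a).1, (g a).2, e a))
    fun F hF hcof href => ?_
  obtain ⟨D, hDF, hD⟩ := exists_pseudoIntersection hcof
    (Sum.elim (fun i => {a | (g a).1 = i}) fun p => {a | g a = p})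
  refine ⟨D, fun hmem => ?_, hDF⟩
  obtain ⟨hcol, hrow⟩ := (image_prodMk_mem_biSets_iff he).mp hmem
  obtain ⟨G, hG, htendsto, hrowG⟩ := href.exists_tendsto_cofinite_prod hF hg
    (hrow.mono fun i hfin => not_frequently.mp fun hfreq => hD (.inl i) hfreq hfin)
    fun i => (hcol i).mono fun j hfin => not_frequently.mp fun hfreq => hD (.inr (i, j)) hfreq hfin
  exact hno G hG htendsto (hrowG.mono fun i hi => not_frequently.mpr hi)

end Katetov

section FinBW

variable {X : Type*} [TopologicalSpace X]

theorem finBW_of_forall_tendsto_cofinite (h : ∀ f : Λ → X, Tendsto f ρ.dualFilter cofinite →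
    ∃ F ∈ ρ.dom, ∃ x, Tendsto f (ρ.tail F) (𝓝 x)) : ρ.FinBW X := by
  refine finBW_iff_tendsto.mpr fun f => ?_
  by_cases hf : ∀ x, f ⁻¹' {x} ∈ ρ.ideal
  · exact h f (tendsto_dualFilter_cofinite_iff.mpr hf)
  · obtain ⟨x, hx⟩ := not_forall.mp hf
    obtain ⟨F, hF, hFx⟩ :=
      frequently_dualFilter_iff_exists.mp (frequently_dualFilter_iff_notMem_ideal.mpr hx)
    exact ⟨F, hF, x, tendsto_nhds_of_eventually_eq (mem_of_superset (toFun_mem_tail hF) hFx)⟩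

theorem FinBW.of_surjective {Y : Type*} [TopologicalSpace Y] {φ : X → Y} (hX : ρ.FinBW X)
    (hφ : Continuous φ) (hsurj : Function.Surjective φ) : ρ.FinBW Y := by
  refine finBW_iff_tendsto.mpr fun f => ?_
  obtain ⟨F, hF, x, hx⟩ := finBW_iff_tendsto.mp hX (Function.surjInv hsurj ∘ f)
  exact ⟨F, hF, φ x, ((hφ.tendsto x).comp hx).congr fun a => Function.surjInv_eq hsurj (f a)⟩

theorem finBW_ulift_iff : ρ.FinBW (ULift.{u} X) ↔ ρ.FinBW X :=
  ⟨fun h => h.of_surjective continuous_uliftDown ULift.down_surjective,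
    fun h => h.of_surjective continuous_uliftUp ULift.up_surjective⟩

theorem FinBW.seqCompactSpace [Countable Ω] [Countable Λ] (hX : ρ.FinBW X) :
    SeqCompactSpace X := by
  refine ⟨fun s _ => ?_⟩
  obtain ⟨e, he⟩ := exists_injective_nat Λ
  obtain ⟨E, hE, x, hx⟩ := finBW_iff_tendsto.mp hX (s ∘ e)
  obtain ⟨F, hF, hFE, hcof⟩ := exists_tail_le_cofinite hE
  have := tail_neBot hF
  obtain ⟨a, ha⟩ := exists_seq_tendsto (ρ.tail F)
  have hea : Tendsto (e ∘ a) atTop atTop :=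
    (Nat.cofinite_eq_atTop ▸ he.tendsto_cofinite).comp (ha.mono_right hcof)
  obtain ⟨k, hk, hmono⟩ := strictMono_subseq_of_tendsto_atTop hea
  exact ⟨x, mem_univ x, e ∘ a ∘ k, hmono,
    (hx.mono_left (tail_mono hF hE hFE)).comp (ha.comp hk.tendsto_atTop)⟩

theorem S2.finBW_of_boringSpace [Countable Λ] [T2Space X] (hρ : ρ.S2) (hP : ρ.P1Minus)
    (hX : BoringSpace X) : ρ.FinBW X := by
  refine finBW_of_forall_tendsto_cofinite fun f hf => ?_
  obtain ⟨E, hE, hfE⟩ := hP.exists_tendsto_cofinite hf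
  obtain ⟨F, hF, hFE, -, href⟩ := hρ.exists_isRefinable hE
  obtain ⟨T, U, hT, hU, hlim⟩ := hX.exists_finite_cover
  obtain ⟨x, hx, G, hG, hGF⟩ := href.exists_of_eventually_exists hF hT (B := fun x => f ⁻¹' U x)
    ((hf.eventually hU).mono fun a ha => mem_iUnion₂.mp ha |>.imp fun _ => exists_prop.mp)
  have hfG : Tendsto f (ρ.tail G) (cofinite ⊓ 𝓟 (U x)) :=
    ((hfE.mono_left hFE).inf (tendsto_principal_principal.mpr fun _ ha => ha)).mono_left hGF
  exact ⟨G, hG, x, hfG.mono_right (hlim x hx)⟩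

theorem S2.exists_tendsto_nhdsNE [T2Space X] (hρ : ρ.S2) (hX : ρ.FinBW X) {f : Λ → X}
    (hf : Tendsto f ρ.dualFilter cofinite) :
    ∃ F ∈ ρ.dom, ∃ x, Tendsto f (ρ.tail F) (𝓝[≠] x) := by
  obtain ⟨E, hE, x, hx⟩ := finBW_iff_tendsto.mp hX f
  obtain ⟨F, hF, hFE, -, href⟩ := hρ.exists_isRefinable hE
  obtain ⟨G, hG, hGF⟩ := href.exists_of_mem_dualFilter hF (hf (eventually_cofinite_ne x))
  refine ⟨G, hG, x, tendsto_nhdsWithin_iff.mpr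
    ⟨hx.mono_left (hGF.trans (inf_le_left.trans hFE)), ?_⟩⟩
  exact hGF (mem_inf_of_right (mem_principal_self _))

theorem S2.p1Minus_of_finBW [T2Space X] [Infinite X] (hρ : ρ.S2) (hX : ρ.FinBW X) :
    ρ.P1Minus := by
  refine p1Minus_iff.mpr fun g hg => ?_
  let s : ℕ ↪ X := Infinite.natEmbedding X
  obtain ⟨F, hF, x, hx⟩ := hρ.exists_tendsto_nhdsNE hX (s.injective.tendsto_cofinite.comp hg)
  exact ⟨F, hF, (tendsto_comp_cofinite_iff_of_injOn s.injective.injOn).mp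
    (hx.mono_right (nhdsNE_le_cofinite x))⟩

theorem S2.boringSpace_of_finBW [Countable Ω] [Countable Λ] [T2Space X] (hρ : ρ.S2)
    (hP : ¬ ρ.P2Minus) (hX : ρ.FinBW X) : BoringSpace X := by
  refine boringSpace_iff_finite_injectiveLimits.mpr
    ⟨hX.seqCompactSpace, not_infinite.mp fun hinf => hP ?_⟩
  obtain ⟨x, s, hx, hs, hlim⟩ := exists_injective_prod_tendsto hinf
  refine p2Minus_iff.mpr fun g hg => ?_
  obtain ⟨F, hF, y, hy⟩ := hρ.exists_tendsto_nhdsNE hX (hs.tendsto_cofinite.comp hg)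
  refine ⟨F, hF, (tendsto_comp_cofinite_iff_of_injOn hs.injOn).mp
    (hy.mono_right (nhdsNE_le_cofinite y)), ?_⟩
  filter_upwards [hx.tendsto_cofinite.eventually (eventually_cofinite_ne y)] with i hi
  filter_upwards [hy.eventually (eventually_nhdsNE_notMem_range (hlim i) hi)] with a ha
  rintro rfl
  exact ha (mem_range_self (g a).2)

theorem S2.finBW_onePoint_prod [Countable Λ] {Y : Type*} [TopologicalSpace Y] {y : Y}
    (hy : cofinite ≤ 𝓝 y) (hρ : ρ.S2) (hP : ρ.P2Minus) : ρ.FinBW (OnePoint (ℕ × Y)) := by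
  refine finBW_of_forall_tendsto_cofinite fun f hf => ?_
  obtain ⟨E, hE, hfE, hrowE⟩ := hP.exists_tendsto_cofinite hf fun x => x.elim 0 Prod.fst
  obtain ⟨F, hF, hFE, -, href⟩ := hρ.exists_isRefinable hE
  by_cases hpos : ∃ i, ∃ᶠ a in ρ.dualFilter, a ∈ ρ.toFun F ∩ f ⁻¹' onePointRow Y i
  · obtain ⟨i, hi⟩ := hpos
    obtain ⟨G, hG, hGF⟩ : ∃ G ∈ ρ.dom, ρ.tail G ≤ ρ.tail F ⊓ 𝓟 (f ⁻¹' onePointRow Y i) :=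
      href _ hi
    have hfG : Tendsto f (ρ.tail G) (cofinite ⊓ 𝓟 (onePointRow Y i)) :=
      ((hfE.mono_left hFE).inf
        (tendsto_principal_principal.mpr fun _ ha => ha)).mono_left hGF
    exact ⟨G, hG, _, hfG.mono_right (cofinite_inf_onePointRow_le_nhds hy i)⟩
  · let T : Set ℕ := {i | ¬ ∀ᶠ a in ρ.tail F, f a ∉ onePointRow Y i}
    have hT : T.Finite := hrowE.mono fun i hi =>
      (hi.filter_mono hFE).mono fun a ha ⟨z, hz⟩ => ha (hz ▸ rfl)
    simp only [not_exists, not_frequently] at hpos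
    obtain ⟨G, hG, hGF⟩ := href.exists_of_mem_dualFilter hF
      ((eventually_all_finite hT).mpr fun i _ => hpos i)
    have hGT : ∀ᶠ a in ρ.tail G, ∀ i ∈ T, a ∉ ρ.toFun F ∩ f ⁻¹' onePointRow Y i :=
      hGF (mem_inf_of_right (mem_principal_self _))
    refine ⟨G, hG, OnePoint.infty, le_nhds_infty_of_forall_notMem_onePointRow fun i => ?_⟩
    rw [eventually_map]
    by_cases hi : i ∈ T
    · filter_upwards [hGF (mem_inf_of_left (toFun_mem_tail hF)), hGT] with a haF haT haRow
      exact haT i hi ⟨haF, haRow⟩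
    · exact (not_not.mp hi).filter_mono (hGF.trans inf_le_left)

end FinBW

end PartitionRegular

theorem mainTheorem2 {Ω : Type v} {Λ : Type w} [Countable Ω] [Infinite Ω] [Countable Λ]
    [Infinite Λ] (ρ : PartitionRegular Ω Λ) (hρ : ρ.S2) :
    List.TFAE [
      PartitionRegular.KatetovLE idealBI.rho ρ ∧ ¬ PartitionRegular.KatetovLE idealFIN2.rho ρ,
      ρ.P1Minus ∧ ¬ ρ.P2Minus,
      ∀ (X : Type u) [TopologicalSpace X] [T2Space X], ρ.FinBW X ↔ BoringSpace X] := by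
  tfae_have 1 ↔ 2 := by
    rw [hρ.katetovLE_bi_iff, hρ.katetovLE_fin2_iff, not_not, and_comm]
  tfae_have 2 → 3 := fun ⟨hP1, hP2⟩ X _ _ =>
    ⟨hρ.boringSpace_of_finBW hP2, hρ.finBW_of_boringSpace hP1⟩
  tfae_have 3 → 2 := by
    intro h
    have hType (X : Type) [TopologicalSpace X] [T2Space X] : ρ.FinBW X ↔ BoringSpace X := by
      simpa only [PartitionRegular.finBW_ulift_iff, boringSpace_ulift_iff] using h (ULift.{u} X)
    exact ⟨hρ.p1Minus_of_finBW ((hType ℕ∞).mpr boringSpace_enat), fun hP2 =>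
      not_boringSpace_onePoint ((hType _).mp (hρ.finBW_onePoint_prod cofinite_le_nhds_top hP2))⟩
  tfae_finish
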